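/- A server has $N$ files and is connected to $K$ users by an error-free broadcast link, where $1\le K\le N$. Let $0\le M\le N$ be real. In the placement phase, before the demands are known, user $k$ stores an arbitrary set of bits of the files in a cache of size $m_k\ge0$ (uncoded placement). In the delivery phase user $k$ demands file $d_k\in\{1,\dots,N\}$, and the server, knowing $d=(d_1,\dots,d_K)$, broadcasts a signal computed from all the files; from this signal and the content of the own cache each user recovers the demanded file. Lengths are measured in a common unit. For file sizes $f_1,\dots,f_N\ge0$ and cache sizes $m_1,\dots,m_K\ge 0$, a load $L$ is achievable (by schemes of a given class) if for every $\varepsilon>0$ and all sufficiently large $b$, with a unit of $b$ bits, there is a scheme with uncoded placement (in that class) for files of $\lceil f_i b\rceil$ bits and caches of at most $m_k b$ bits such that, for every demand vector $d\in\{1,\dots,N\}^K$, at most $(L+\varepsilon)b$ bits are broadcast and every user fails to recover its file with probability at most $\varepsilon$, the file bits being independent and uniform. Suppose that only the total sizes are constrained, by $\frac1N\sum_i f_i\ge 1$ and $\frac1K\sum_k m_k\le M$. Let $L^\star(M)$ be the function whose value at $M=tN/K$, $t\in\{0,1,\dots,K\}$, is $$\frac{K(1-M/N)}{1+KM/N}=\frac{K-t}{t+1},$$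 and which is linear between consecutive such points. (a) $L^\star(M)$ is the minimum of all loads $L$ that are achievable for some $(f_i)$, $(m_k)$ satisfying the two constraints. (b) This minimum is attained with $f_1=\dots=f_N=1$ and $m_1=\dots=m_K=M$ by Maddah-Ali–Niesen coded caching schemes with time-sharing. Here the Maddah-Ali–Niesen scheme with parameter $t\in\{0,\dots,K\}$ splits each file into $\binom Kt$ subfiles $F_{i,W}$ of equal size, $W\subseteq\{1,\dots,K\}$, $|W|=t$; user $k$ stores all $F_{i,W}$ with $k\in W$; and for every $T\subseteq\{1,\dots,K\}$ with $|T|=t+1$ the server sends $\bigoplus_{s\in T}F_{d_s,T\setminus\{s\}}$. Time-sharing splits each file into two parts, each served by its own scheme. (c) If $M=tN/K$ with $t\in\{0,\dots,K\}$, then the Maddah-Ali–Niesen scheme with parameter $t$ and subfiles of any number $c$ of bits has files of one unit (of $b=\binom Kt c$ bits) each and caches of exactly $M$ units each, sends exactly $L^\star(M)$ units for every demand vector, and recovers every demanded file without error. If $t<K$ and $M$ is the corresponding weighted average of $tN/K$ and $(t+1)N/K$, with weights proportional to the two parts of each file, the same holds for time-sharing between the schemes with parameters $t$ and $t+1$.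 -/

import Mathlib

open Filter

namespace CodedCaching

/-- A caching scheme with uncoded placement for a server with `N` files and `K` users, at a fixed
number of bits.  The bits of file `i` are indexed by the finite type `Bit i`, and a bit is an
element of `ZMod 2`, so that `+` is XOR.  User `k` stores an (arbitrary) set of bits of each file,
chosen before the demands are known.  When user `k` demands file `d k`, the server broadcasts a
signal whose bits are indexed by the finite type `Tx d` and which may depend on all files; every
user then computes an estimate of the requested file from the signal and the own cache. -/
structure Scheme (N K : ℕ) where
  Bit : Fin N → Type
  [fintypeBit : ∀ i, Fintype (Bit i)]
  cache : Fin K → ∀ i, Finset (Bit i)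
  Tx : (Fin K → Fin N) → Type
  [fintypeTx : ∀ d, Fintype (Tx d)]
  encode : ∀ d : Fin K → Fin N, (∀ i, Bit i → ZMod 2) → (Tx d → ZMod 2)
  decode : ∀ (d : Fin K → Fin N) (k : Fin K),
    (Tx d → ZMod 2) → (∀ i, {p : Bit i // p ∈ cache k i} → ZMod 2) → (Bit (d k) → ZMod 2)

attribute [instance] Scheme.fintypeBit Scheme.fintypeTx

namespace Scheme

variable {N K : ℕ} (S : Scheme N K)

/-- All the file contents. -/
abbrev Library : Type := ∀ i, S.Bit i → ZMod 2

/-- Length in bits of file `i`. -/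
def fileLength (i : Fin N) : ℕ := Fintype.card (S.Bit i)

/-- Number of bits in the cache of user `k`. -/
def cacheLength (k : Fin K) : ℕ := ∑ i, (S.cache k i).card

/-- Length in bits of the signal sent for the demand vector `d`. -/
def signalLength (d : Fin K → Fin N) : ℕ := Fintype.card (S.Tx d)

/-- The content of the cache of user `k`. -/
def cacheContent (k : Fin K) (F : S.Library) (i : Fin N)
    (p : {p : S.Bit i // p ∈ S.cache k i}) : ZMod 2 := F i p.1

/-- User `k` recovers the requested file when the files are `F` and the demands are `d`. -/
def Recovers (d : Fin K → Fin N) (k : Fin K) (F : S.Library) : Prop :=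
  S.decode d k (S.encode d F) (S.cacheContent k F) = F (d k)

/-- Probability that user `k` does not recover the requested file under the demands `d`, when the
files are independent and uniformly distributed. -/
noncomputable def errorProb (d : Fin K → Fin N) (k : Fin K) : ℝ :=
  (Nat.card {F : S.Library // ¬ S.Recovers d k F} : ℝ) / (Nat.card S.Library : ℝ)

/-- The scheme `S`, used with `b` bits for one unit of length, has files of length one unit each,
caches of `M` units each, a signal of `L` units for every demand vector, and every user always
recovers the requested file. -/
def Performs (b : ℕ) (M L : ℝ) : Prop :=
  (∀ i, S.fileLength i = b) ∧ (∀ k, (S.cacheLength k : ℝ) = M * b) ∧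
  (∀ d, (S.signalLength d : ℝ) = L * b) ∧ ∀ d k F, S.Recovers d k F

end Scheme

/-- Load `L` is achievable by schemes in the class `C`, for file sizes `f` and cache sizes `m`:
for every `ε > 0`, if the unit of length is `b` bits and `b` is large enough, then some scheme
in `C` for files of `⌈f i * b⌉` bits and caches of at most `m k * b` bits sends at most
`(L + ε) * b` bits for each demand vector, and every user recovers the requested file with
error probability at most `ε`. -/
def AchievableBy {N K : ℕ} (C : Set (Scheme N K)) (f : Fin N → ℝ) (m : Fin K → ℝ) (L : ℝ) : Prop :=
  ∀ ε : ℝ, 0 < ε → ∀ᶠ b : ℕ in atTop, ∃ S ∈ C,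
    (∀ i, S.fileLength i = ⌈f i * b⌉₊) ∧
    (∀ k, (S.cacheLength k : ℝ) ≤ m k * b) ∧
    (∀ d, (S.signalLength d : ℝ) ≤ (L + ε) * b) ∧
    (∀ d k, S.errorProb d k ≤ ε)

/-- Achievable worst-case loads for uncoded placement when only the total file size (at least `N`
units) and the total cache size (at most `K * M` units) are constrained. -/
def achievableLoads (N K : ℕ) (M : ℝ) : Set ℝ :=
  {L | ∃ (f : Fin N → ℝ) (m : Fin K → ℝ), (∀ i, 0 ≤ f i) ∧ (∀ k, 0 ≤ m k) ∧
    1 ≤ (1 / (N : ℝ)) * ∑ i, f i ∧ (1 / (K : ℝ)) * ∑ k, m k ≤ M ∧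
    AchievableBy Set.univ f m L}

/-- The coded caching scheme of Maddah-Ali and Niesen with parameter `t` and subfiles of `c` bits.
Each file is split into subfiles indexed by the sets `W` of `t` users; user `k` stores the
subfiles with `k ∈ W`; for each set `T` of `t + 1` users the server sends the XOR over `s ∈ T` of
the subfile `T \ {s}` of the file that user `s` demands. -/
def manScheme (N K t c : ℕ) : Scheme N K where
  Bit _ := {W : Finset (Fin K) // W.card = t} × Fin c
  cache k _ := Finset.univ.filter fun p => k ∈ p.1.1
  Tx _ := {T : Finset (Fin K) // T.card = t + 1} × Fin c
  encode d F q := ∑ s : {s : Fin K // s ∈ q.1.1},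
    F (d s.1) (⟨q.1.1.erase s.1, by rw [Finset.card_erase_of_mem s.2, q.1.2]; rfl⟩, q.2)
  decode d k x z p :=
    if h : k ∈ p.1.1 then z (d k) ⟨p, by simpa using h⟩
    else
      x (⟨insert k p.1.1, by rw [Finset.card_insert_of_notMem h, p.1.2]⟩, p.2) -
      ∑ s : {s : Fin K // s ∈ p.1.1},
        z (d s.1) ⟨(⟨(insert k p.1.1).erase s.1, by
            rw [Finset.card_erase_of_mem (Finset.mem_insert_of_mem s.2),
              Finset.card_insert_of_notMem h, p.1.2]; rfl⟩, p.2), by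
          have hs : k ≠ s.1 := fun e => h (e ▸ s.2)
          simp [hs]⟩

/-- Time-sharing: each file is split into two parts, which are served by `S` and `S'`. -/
def timeShare {N K : ℕ} (S S' : Scheme N K) : Scheme N K where
  Bit i := S.Bit i ⊕ S'.Bit i
  cache k i := (S.cache k i).disjSum (S'.cache k i)
  Tx d := S.Tx d ⊕ S'.Tx d
  encode d F := Sum.elim (S.encode d fun i p => F i (.inl p)) (S'.encode d fun i p => F i (.inr p))
  decode d k x z := Sum.elim
    (S.decode d k (fun q => x (.inl q)) fun i p => z i ⟨.inl p.1, by simp⟩)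
    (S'.decode d k (fun q => x (.inr q)) fun i p => z i ⟨.inr p.1, by simp⟩)

/-- The schemes obtained from the Maddah-Ali--Niesen schemes by time-sharing. -/
inductive IsCodedCaching {N K : ℕ} : Scheme N K → Prop
  | man (t c : ℕ) : t ≤ K → IsCodedCaching (manScheme N K t c)
  | share (S S' : Scheme N K) : IsCodedCaching S → IsCodedCaching S' →
      IsCodedCaching (timeShare S S')

/-- The load `K (1 - M / N) / (1 + K M / N)`. -/
noncomputable def cornerLoad (N K : ℕ) (M : ℝ) : ℝ :=
  K * (1 - M / N) * (1 / (1 + K * M / N))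

/-- The piecewise linear interpolation of `cornerLoad` between the points `M = t N / K`,
for natural numbers `t`. -/
noncomputable def optimalLoad (N K : ℕ) (M : ℝ) : ℝ :=
  let t : ℕ := ⌊K * M / N⌋₊
  let θ : ℝ := K * M / N - t
  (1 - θ) * cornerLoad N K (t * N / K) + θ * cornerLoad N K ((t + 1) * N / K)

end CodedCaching

/-! Achievability: at the corner points the load is a count of subsets, and on the segments between
them time-sharing interpolates; the few bits lost to rounding are sent uncached. Converse: take
distinct demands, possible since `K ≤ N`, and an ordering of the users. Decoding user after user,
each with the files found before, shows that the signal is at least as long as the requested bits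
that neither the requesting user nor any earlier one stores, up to one bit that pays for decoding
errors (`sum_card_uncachedUpTo_le`). Average over all orderings and all cyclic shifts of the
demands. A bit stored by `w` users is counted once for each user preceding all its holders; each of
the `K - w` other users does so with probability `1 / (w + 1)`. Hence `N` times the load is at least
the sum of `(K - w) / (w + 1)` over all bits, up to that slack (`sum_sum_card_uncachedUpTo`). The
chord through `t` and `t + 1` lies below this function at the integers (`chord_le`), and its sum
over the bits sees only the total file size and the total cache size. So unequal sizes cannot help.
-/

namespace CodedCaching

open Finset

namespace Scheme

variable {N K : ℕ}

theorem errorProb_eq_zero {S : Scheme N K} {d : Fin K → Fin N} {k : Fin K}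
    (h : ∀ F, S.Recovers d k F) : S.errorProb d k = 0 := by
  simp [errorProb, h]

end Scheme

/-! ### Lengths and correctness of the coded caching schemes -/

section Schemes

variable {N K : ℕ}

theorem manScheme_fileLength (t c : ℕ) (i : Fin N) :
    (manScheme N K t c).fileLength i = K.choose t * c := by
  change Fintype.card ({W : Finset (Fin K) // W.card = t} × Fin c) = _
  simp

theorem manScheme_signalLength (t c : ℕ) (d : Fin K → Fin N) :
    (manScheme N K t c).signalLength d = K.choose (t + 1) * c := by
  change Fintype.card ({T : Finset (Fin K) // T.card = t + 1} × Fin c) = _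
  simp

/-- The number of `t`-subsets of the users that contain a given user `k`, times `K`. -/
theorem card_mul_card_filter_mem (t : ℕ) (k : Fin K) :
    K * (univ.filter fun W : {W : Finset (Fin K) // W.card = t} => k ∈ W.1).card =
      t * K.choose t := by
  have hsymm : ∀ k' : Fin K,
      (univ.filter fun W : {W : Finset (Fin K) // W.card = t} => k' ∈ W.1).card =
      (univ.filter fun W : {W : Finset (Fin K) // W.card = t} => k ∈ W.1).card := by
    intro k'
    let e : Equiv.Perm (Fin K) := Equiv.swap k k'
    refine card_bij (fun W _ => ⟨W.1.map e.toEmbedding, by simp [W.2]⟩) ?_ ?_ ?_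
    · intro W hW
      simp only [mem_filter, mem_univ, true_and] at hW ⊢
      exact mem_map.2 ⟨k', hW, by simp [e]⟩
    · intro W _ W' _ h
      simpa [Subtype.ext_iff] using h
    · intro W hW
      simp only [mem_filter, mem_univ, true_and] at hW
      refine ⟨⟨W.1.map e.toEmbedding, by simp [W.2]⟩, ?_, ?_⟩
      · simp only [mem_filter, mem_univ, true_and]
        exact mem_map.2 ⟨k, hW, by simp [e]⟩
      · apply Subtype.ext
        ext x
        simp [e, mem_map_equiv]
  -- Pairs of a user and a subset containing it, counted both ways.
  have hdc := sum_card_bipartiteAbove_eq_sum_card_bipartiteBelow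
    (s := (univ : Finset (Fin K))) (t := (univ : Finset {W : Finset (Fin K) // W.card = t}))
    (fun k W => k ∈ W.1)
  simp only [bipartiteAbove, bipartiteBelow, hsymm, sum_const, card_univ, Fintype.card_fin,
    smul_eq_mul, filter_univ_mem] at hdc
  rw [hdc, sum_congr rfl fun W _ => W.2]
  simp [mul_comm]

theorem manScheme_cacheLength (t c : ℕ) (k : Fin K) :
    K * (manScheme N K t c).cacheLength k = N * (t * (K.choose t * c)) := by
  have h : ∀ i, ((manScheme N K t c).cache k i).card =
      (univ.filter fun W : {W : Finset (Fin K) // W.card = t} => k ∈ W.1).card * c := by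
    intro i
    change (univ.filter fun p : {W : Finset (Fin K) // W.card = t} × Fin c => k ∈ p.1.1).card = _
    have : (univ.filter fun p : {W : Finset (Fin K) // W.card = t} × Fin c => k ∈ p.1.1) =
        (univ.filter fun W : {W : Finset (Fin K) // W.card = t} => k ∈ W.1) ×ˢ
          (univ : Finset (Fin c)) := by
      ext p; simp
    rw [this, card_product]; simp
  simp only [Scheme.cacheLength, h, sum_const, card_univ, Fintype.card_fin, smul_eq_mul]
  rw [← mul_assoc t, ← card_mul_card_filter_mem t k]
  ring

/-- For `k ∉ W`, the transmission for `T = insert k W` contains the wanted subfile; every other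
summand has index `T \ {s}` with `s ≠ k`, which contains `k`, so it is cached and can be subtracted.
-/
theorem manScheme_recovers (t c : ℕ) (d : Fin K → Fin N) (k : Fin K)
    (F : (manScheme N K t c).Library) : (manScheme N K t c).Recovers d k F := by
  unfold Scheme.Recovers
  funext p
  change {W : Finset (Fin K) // W.card = t} × Fin c at p
  obtain ⟨⟨W, hW⟩, q⟩ := p
  by_cases h : k ∈ W
  · simp [manScheme, h, Scheme.cacheContent]
  · have key : ∀ G : Fin K → ZMod 2, ∑ s : {s : Fin K // s ∈ insert k W}, G s.1 =
        G k + ∑ s : {s : Fin K // s ∈ W}, G s.1 := by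
      intro G
      rw [← sum_subtype (insert k W) (fun _ => Iff.rfl) G, sum_insert h,
        ← sum_subtype W (fun _ => Iff.rfl) G]
    -- A total function frees the sums from the cardinality proofs; the default 0 is never met on
    -- `insert k W`.
    let G : Fin K → ZMod 2 := fun s => if hs : ((insert k W).erase s).card = t then
      F (d s) (⟨(insert k W).erase s, hs⟩, q) else 0
    have hG : ∀ s ∈ insert k W, ((insert k W).erase s).card = t := fun s hs => by
      rw [card_erase_of_mem hs, card_insert_of_notMem h, hW]; rfl
    have hGv : ∀ s (hs : s ∈ insert k W), G s = F (d s) (⟨(insert k W).erase s, hG s hs⟩, q) :=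
      fun s hs => dif_pos (hG s hs)
    have hGk : G k = F (d k) (⟨W, hW⟩, q) := by simp [G, erase_insert h, hW]
    have hdec : (manScheme N K t c).decode d k ((manScheme N K t c).encode d F)
        ((manScheme N K t c).cacheContent k F) (⟨W, hW⟩, q) =
        ∑ s : {s : Fin K // s ∈ insert k W}, G s.1 - ∑ s : {s : Fin K // s ∈ W}, G s.1 := by
      refine (dif_neg h).trans (congrArg₂ _ (sum_congr rfl fun s _ => ?_)
        (sum_congr rfl fun s _ => ?_))
      · exact (hGv s.1 s.2).symm
      · exact (hGv s.1 (mem_insert_of_mem s.2)).symm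
    rw [hdec, key, hGk, add_sub_cancel_right]

theorem timeShare_fileLength (S S' : Scheme N K) (i : Fin N) :
    (timeShare S S').fileLength i = S.fileLength i + S'.fileLength i := by
  change Fintype.card (S.Bit i ⊕ S'.Bit i) = _
  rw [Fintype.card_sum]; rfl

theorem timeShare_signalLength (S S' : Scheme N K) (d : Fin K → Fin N) :
    (timeShare S S').signalLength d = S.signalLength d + S'.signalLength d := by
  change Fintype.card (S.Tx d ⊕ S'.Tx d) = _
  rw [Fintype.card_sum]; rfl

theorem timeShare_cacheLength (S S' : Scheme N K) (k : Fin K) :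
    (timeShare S S').cacheLength k = S.cacheLength k + S'.cacheLength k := by
  simp only [Scheme.cacheLength, ← sum_add_distrib]
  exact sum_congr rfl fun i _ => card_disjSum _ _

theorem timeShare_recovers {S S' : Scheme N K} {d : Fin K → Fin N} {k : Fin K}
    (h : ∀ F, S.Recovers d k F) (h' : ∀ F, S'.Recovers d k F) (F : (timeShare S S').Library) :
    (timeShare S S').Recovers d k F := by
  funext p
  rcases p with p | p
  · exact congrFun (h fun i p => F i (.inl p)) p
  · exact congrFun (h' fun i p => F i (.inr p)) p

end Schemes

/-! ### The interpolated load and its achievability -/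

section Load

variable {N K : ℕ}

theorem cornerLoad_corner (hK : 0 < K) (hN : 0 < N) (t : ℕ) :
    cornerLoad N K (t * N / K) = ((K : ℝ) - t) / (t + 1) := by
  have hK' : (K : ℝ) ≠ 0 := by positivity
  have hN' : (N : ℝ) ≠ 0 := by positivity
  have h1 : (K : ℝ) * (t * N / K) / N = t := by field_simp
  rw [cornerLoad, h1]
  have : (t * N / K : ℝ) / N = t / K := by field_simp
  rw [this]
  field_simp
  ring

/-- Allowing `θ = 1`, where the floor is already `t + 1`, is harmless because adjacent segments
agree at their common corner. -/
theorem optimalLoad_eq (hK : 0 < K) (hN : 0 < N) {M θ : ℝ} (t : ℕ)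
    (hM : K * M / N = t + θ) (h0 : 0 ≤ θ) (h1 : θ ≤ 1) :
    optimalLoad N K M =
      (1 - θ) * (((K : ℝ) - t) / (t + 1)) + θ * (((K : ℝ) - (t + 1)) / (t + 2)) := by
  have hc : ∀ s : ℕ, cornerLoad N K ((s + 1) * N / K) = ((K : ℝ) - (s + 1)) / (s + 2) := by
    intro s
    have := cornerLoad_corner hK hN (s + 1)
    push_cast at this
    rw [this]; ring
  rcases h1.lt_or_eq with h1 | rfl
  · have hf : ⌊(K : ℝ) * M / N⌋₊ = t := by
      rw [hM, Nat.floor_eq_iff (by positivity)]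
      constructor <;> linarith
    simp only [optimalLoad, hf, hc, cornerLoad_corner hK hN]
    rw [hM]; ring
  · have hf : ⌊(K : ℝ) * M / N⌋₊ = t + 1 := by
      rw [hM, Nat.floor_eq_iff (by positivity)]
      push_cast
      constructor <;> linarith
    simp only [optimalLoad, hf, hc, cornerLoad_corner hK hN]
    rw [hM]; push_cast; ring

theorem choose_succ_eq (t : ℕ) :
    (K.choose (t + 1) : ℝ) = ((K : ℝ) - t) / (t + 1) * K.choose t := by
  have := Nat.choose_succ_right_eq K t
  rcases le_or_gt t K with h | h
  · have h2 : (K.choose (t + 1) : ℝ) * (t + 1) = K.choose t * (K - t) := by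
      rw [← Nat.cast_sub h]; exact_mod_cast this
    field_simp
    linarith
  · simp [Nat.choose_eq_zero_of_lt h, Nat.choose_eq_zero_of_lt (Nat.lt_succ_of_lt h)]

theorem manScheme_cacheLength_real (hK : 0 < K) (t c : ℕ) (k : Fin K) :
    ((manScheme N K t c).cacheLength k : ℝ) = t * N / K * (K.choose t * c : ℕ) := by
  have h := manScheme_cacheLength (N := N) t c k
  have h2 : (K : ℝ) * (manScheme N K t c).cacheLength k = N * (t * (K.choose t * c : ℕ)) := by
    exact_mod_cast h
  have : (K : ℝ) ≠ 0 := by positivity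
  field_simp
  linarith

theorem manScheme_signalLength_real (t c : ℕ) (d : Fin K → Fin N) :
    ((manScheme N K t c).signalLength d : ℝ) =
      ((K : ℝ) - t) / (t + 1) * (K.choose t * c : ℕ) := by
  rw [manScheme_signalLength]
  push_cast
  rw [choose_succ_eq]
  ring

theorem timeShare_performs (hK : 0 < K) (hN : 0 < N) {M : ℝ} (t c c' b b' : ℕ)
    (hb : b = K.choose t * c) (hb' : b' = K.choose (t + 1) * c')
    (hM : M * (b + b') = b * (t * N / K) + b' * ((t + 1) * N / K)) :
    (timeShare (manScheme N K t c) (manScheme N K (t + 1) c')).Performs (b + b') M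
      (optimalLoad N K M) := by
  refine ⟨fun i => ?_, fun k => ?_, fun d => ?_, fun d k => timeShare_recovers
    (manScheme_recovers _ _ _ _) (manScheme_recovers _ _ _ _)⟩
  · rw [timeShare_fileLength, manScheme_fileLength, manScheme_fileLength, hb, hb']
  · rw [timeShare_cacheLength, Nat.cast_add, manScheme_cacheLength_real hK,
      manScheme_cacheLength_real hK, ← hb, ← hb']
    push_cast
    rw [hM]; ring
  · rw [timeShare_signalLength, Nat.cast_add, manScheme_signalLength_real,
      manScheme_signalLength_real, ← hb, ← hb']
    rcases Nat.eq_zero_or_pos (b + b') with h0 | hpos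
    · obtain ⟨rfl, rfl⟩ : b = 0 ∧ b' = 0 := by omega
      simp
    · have hp : (0 : ℝ) < b + b' := by exact_mod_cast hpos
      have hK' : (K : ℝ) ≠ 0 := by positivity
      have hN' : (N : ℝ) ≠ 0 := by positivity
      have hM' : K * M / N = t + (b' : ℝ) / (b + b') := by
        field_simp
        field_simp at hM
        linarith
      rw [optimalLoad_eq hK hN t hM' (by positivity) (by rw [div_le_one hp]; simp)]
      push_cast
      have : (1 - (b' : ℝ) / (b + b')) = b / (b + b') := by field_simp; ring
      rw [this]
      field_simp
      ring

theorem manScheme_performs (hK : 0 < K) (hN : 0 < N) {M : ℝ} (t c : ℕ)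
    (hM : M = t * N / K) :
    (manScheme N K t c).Performs (K.choose t * c) M (optimalLoad N K M) := by
  have hK' : (K : ℝ) ≠ 0 := by positivity
  have hN' : (N : ℝ) ≠ 0 := by positivity
  have hM' : K * M / N = t + 0 := by rw [hM]; field_simp; simp
  refine ⟨manScheme_fileLength _ _, fun k => ?_, fun d => ?_, fun d k =>
    manScheme_recovers _ _ _ _⟩
  · rw [manScheme_cacheLength_real hK, hM]
  · rw [manScheme_signalLength_real, optimalLoad_eq hK hN t hM' le_rfl zero_le_one]
    ring

/-- Coded caching with time-sharing achieves the interpolated curve. -/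
theorem achievableBy_isCodedCaching (hK : 0 < K) (hN : 0 < N) {M : ℝ} (hM0 : 0 ≤ M)
    (hMN : M ≤ N) :
    AchievableBy {S : Scheme N K | IsCodedCaching S} (fun _ => 1) (fun _ => M)
      (optimalLoad N K M) := by
  have hK' : (0 : ℝ) < K := by positivity
  have hN' : (0 : ℝ) < N := by positivity
  obtain ⟨t, θ, htK, hM, h0, h1⟩ : ∃ (t : ℕ) (θ : ℝ), t + 1 ≤ K ∧ K * M / N = t + θ ∧
      0 ≤ θ ∧ θ ≤ 1 := by
    rcases hMN.lt_or_eq with h | rfl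
    · have hx : 0 ≤ K * M / N := by positivity
      refine ⟨⌊K * M / N⌋₊, K * M / N - ⌊K * M / N⌋₊, ?_, by ring, ?_, ?_⟩
      · rw [Nat.succ_le_iff, Nat.floor_lt hx, div_lt_iff₀ hN']
        gcongr
      · linarith [Nat.floor_le hx]
      · linarith [Nat.lt_floor_add_one ((K : ℝ) * M / N)]
    -- At `M = N` the floor is `K`, leaving no scheme with parameter `t + 1`; the right end of the
    -- last segment serves instead.
    · refine ⟨K - 1, 1, by omega, ?_, zero_le_one, le_rfl⟩
      rw [Nat.cast_sub hK]
      field_simp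
      push_cast
      ring
  have hMval : M = (t + θ) * N / K := by rw [← hM]; field_simp
  intro ε hε
  have hch : 0 < (K.choose t : ℝ) := by
    exact_mod_cast Nat.choose_pos (by omega)
  have hch' : 0 < (K.choose (t + 1) : ℝ) := by
    exact_mod_cast Nat.choose_pos htK
  -- Rounding loses less than one bit per subfile, and each lost bit costs `K` bits of signal; the
  -- total must stay within `ε * b`.
  have hlarge : ∀ᶠ b : ℕ in atTop,
      (K : ℝ) * (K.choose t + K.choose (t + 1)) / ε ≤ b :=
    tendsto_natCast_atTop_atTop.eventually_ge_atTop _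
  filter_upwards [hlarge] with b hb
  rw [div_le_iff₀ hε] at hb
  set c := ⌊(1 - θ) * b / K.choose t⌋₊
  set c' := ⌊θ * b / K.choose (t + 1)⌋₊
  have h1θ : 0 ≤ 1 - θ := by linarith
  have hcl : (K.choose t : ℝ) * c ≤ (1 - θ) * b := by
    rw [← le_div_iff₀' hch]; exact Nat.floor_le (by positivity)
  have hcl' : (K.choose (t + 1) : ℝ) * c' ≤ θ * b := by
    rw [← le_div_iff₀' hch']; exact Nat.floor_le (by positivity)
  have hcu : (1 - θ) * b < (K.choose t : ℝ) * (c + 1) := by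
    rw [← div_lt_iff₀' hch]; exact Nat.lt_floor_add_one _
  have hcu' : θ * b < (K.choose (t + 1) : ℝ) * (c' + 1) := by
    rw [← div_lt_iff₀' hch']; exact Nat.lt_floor_add_one _
  obtain ⟨r, hr⟩ : ∃ r, b = K.choose t * c + K.choose (t + 1) * c' + r := by
    apply Nat.exists_eq_add_of_le
    have : (K.choose t : ℝ) * c + K.choose (t + 1) * c' ≤ b := by linarith
    exact_mod_cast this
  have hr' : (b : ℝ) = K.choose t * c + K.choose (t + 1) * c' + r := by exact_mod_cast hr
  -- Parameter 0 serves the `r` leftover bits of each file without using any cache.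
  refine ⟨timeShare (timeShare (manScheme N K t c) (manScheme N K (t + 1) c'))
    (manScheme N K 0 r), ?_, fun i => ?_, fun k => ?_, fun d => ?_, fun d k => ?_⟩
  · exact .share _ _ (.share _ _ (.man _ _ (by omega)) (.man _ _ htK)) (.man _ _ (by omega))
  · simp only [timeShare_fileLength, manScheme_fileLength, one_mul, Nat.ceil_natCast]
    rw [hr]; simp
  · simp only [timeShare_cacheLength, Nat.cast_add, manScheme_cacheLength_real hK, hMval]
    push_cast
    have e : (t * N / K * (K.choose t * c) + (t + 1) * N / K * (K.choose (t + 1) * c') : ℝ)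
        ≤ t * N / K * ((1 - θ) * b) + (t + 1) * N / K * (θ * b) := by gcongr
    calc _ = (t * N / K * (K.choose t * c) + (t + 1) * N / K * (K.choose (t + 1) * c') : ℝ) := by
            ring
      _ ≤ _ := e
      _ = _ := by ring
  · simp only [timeShare_signalLength, Nat.cast_add, manScheme_signalLength_real]
    rw [optimalLoad_eq hK hN t hM h0 h1]
    push_cast
    have hg : 0 ≤ ((K : ℝ) - t) / (t + 1) := by
      apply div_nonneg _ (by positivity)
      have : (t : ℝ) + 1 ≤ K := by exact_mod_cast htK
      linarith
    have hg' : 0 ≤ ((K : ℝ) - (t + 1)) / (t + 1 + 1) := by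
      apply div_nonneg _ (by positivity)
      have : (t : ℝ) + 1 ≤ K := by exact_mod_cast htK
      linarith
    have e1 := mul_le_mul_of_nonneg_left hcl hg
    have e2 := mul_le_mul_of_nonneg_left hcl' hg'
    have e3 : (K : ℝ) * r ≤ K * (K.choose t + K.choose (t + 1)) := by
      gcongr; linarith
    have e4 : (t : ℝ) + 1 + 1 = t + 2 := by ring
    rw [e4] at e2 ⊢
    simp only [Nat.choose_zero_right, Nat.cast_one, one_mul, sub_zero, zero_add, div_one]
    nlinarith [e1, e2, e3, hb]
  · rw [Scheme.errorProb_eq_zero]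
    · exact hε.le
    · exact timeShare_recovers (timeShare_recovers (manScheme_recovers _ _ _ _)
        (manScheme_recovers _ _ _ _)) (manScheme_recovers _ _ _ _)

end Load

end CodedCaching

/-! ### Random orderings of the users, and the chord -/

namespace CodedCaching

open Finset

section Permutations

variable {K : ℕ}

/-- The number of orderings of the users in which a given user `y ∈ V` is the first one of `V`. -/
theorem card_perm_first_mul_card {V : Finset (Fin K)} {y : Fin K} (hy : y ∈ V) :
    (univ.filter fun σ : Equiv.Perm (Fin K) => ∀ z ∈ V, σ y ≤ σ z).card * V.card =
      K.factorial := by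
  -- Swapping `x` and `y` preserves `V`, so both are equally often first; each ordering has exactly
  -- one first element of `V`.
  have hsymm : ∀ x ∈ V, (univ.filter fun σ : Equiv.Perm (Fin K) => ∀ z ∈ V, σ x ≤ σ z).card =
      (univ.filter fun σ : Equiv.Perm (Fin K) => ∀ z ∈ V, σ y ≤ σ z).card := by
    intro x hx
    have hs : ∀ z ∈ V, Equiv.swap x y z ∈ V := by
      intro z hz
      rw [Equiv.swap_apply_def]
      split_ifs <;> assumption
    refine card_equiv (Equiv.mulRight (Equiv.swap x y)) fun σ => ?_
    simp only [mem_filter, mem_univ, true_and, Equiv.coe_mulRight, Equiv.Perm.mul_apply,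
      Equiv.swap_apply_right]
    refine ⟨fun h z hz => h _ (hs z hz), fun h z hz => ?_⟩
    simpa using h _ (hs z hz)
  have hdc := sum_card_bipartiteAbove_eq_sum_card_bipartiteBelow
    (s := V) (t := (univ : Finset (Equiv.Perm (Fin K)))) (fun x σ => ∀ z ∈ V, σ x ≤ σ z)
  simp only [bipartiteAbove, bipartiteBelow] at hdc
  rw [sum_congr rfl hsymm] at hdc
  have hone : ∀ σ : Equiv.Perm (Fin K), (V.filter fun x => ∀ z ∈ V, σ x ≤ σ z).card = 1 := by
    intro σ
    obtain ⟨x, hx, hmin⟩ := V.exists_min_image σ ⟨y, hy⟩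
    rw [card_eq_one]
    refine ⟨x, ?_⟩
    ext z
    simp only [mem_filter, mem_singleton]
    refine ⟨fun h => σ.injective (le_antisymm (h.2 x hx) (hmin z h.1)), ?_⟩
    rintro rfl
    exact ⟨hx, hmin⟩
  simp only [hone, sum_const, smul_eq_mul, card_univ, Fintype.card_perm, Fintype.card_fin,
    mul_one] at hdc
  rw [mul_comm, hdc]

/-- The mean number of users that precede all of `W` in a random ordering. -/
theorem sum_perm_card_before (W : Finset (Fin K)) :
    ∑ σ : Equiv.Perm (Fin K),
      ((univ.filter fun j : Fin K => ∀ l ≤ j, σ l ∉ W).card : ℝ) =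
      K.factorial * (((K : ℝ) - W.card) / (W.card + 1)) := by
  -- Here `σ` maps positions to users: the user at position `j` precedes all of `W` iff it lies
  -- outside `W` and is first in `W` with itself inserted.
  have hbij : ∀ σ : Equiv.Perm (Fin K),
      (univ.filter fun j : Fin K => ∀ l ≤ j, σ l ∉ W).card =
      ((Wᶜ).filter fun x => ∀ z ∈ insert x W, σ⁻¹ x ≤ σ⁻¹ z).card := by
    intro σ
    refine card_equiv σ fun j => ?_
    simp only [mem_filter, mem_univ, true_and, mem_compl, mem_insert, forall_eq_or_imp,
      Equiv.Perm.inv_def, Equiv.symm_apply_apply, le_refl, true_and]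
    refine ⟨fun h => ⟨h j le_rfl, fun z hz => ?_⟩, fun h l hl hlW => ?_⟩
    · by_contra hlt
      exact h (σ.symm z) (not_le.1 hlt).le (by simpa using hz)
    · have := h.2 _ hlW
      rw [Equiv.symm_apply_apply] at this
      obtain rfl := le_antisymm hl this
      exact h.1 hlW
  have hdc := sum_card_bipartiteAbove_eq_sum_card_bipartiteBelow
    (s := Wᶜ) (t := (univ : Finset (Equiv.Perm (Fin K))))
    (fun x σ => ∀ z ∈ insert x W, σ⁻¹ x ≤ σ⁻¹ z)
  simp only [bipartiteAbove, bipartiteBelow] at hdc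
  have hx : ∀ x ∈ Wᶜ, ((univ.filter fun σ : Equiv.Perm (Fin K) =>
      ∀ z ∈ insert x W, σ⁻¹ x ≤ σ⁻¹ z).card : ℝ) = K.factorial / (W.card + 1) := by
    intro x hx
    have h1 := card_perm_first_mul_card (mem_insert_self x W)
    rw [card_insert_of_notMem (mem_compl.1 hx)] at h1
    have h2 : (univ.filter fun σ : Equiv.Perm (Fin K) =>
        ∀ z ∈ insert x W, σ⁻¹ x ≤ σ⁻¹ z).card = (univ.filter fun σ : Equiv.Perm (Fin K) =>
        ∀ z ∈ insert x W, σ x ≤ σ z).card :=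
      card_equiv (Equiv.inv _) fun σ => by simp
    rw [h2, eq_div_iff (by positivity)]
    exact_mod_cast h1
  calc _ = ((∑ σ : Equiv.Perm (Fin K),
        ((Wᶜ).filter fun x => ∀ z ∈ insert x W, σ⁻¹ x ≤ σ⁻¹ z).card : ℕ) : ℝ) := by
        push_cast
        exact sum_congr rfl fun σ _ => by rw [hbij]
    _ = ∑ x ∈ Wᶜ, (K.factorial / (W.card + 1) : ℝ) := by
        rw [← hdc, Nat.cast_sum]
        exact sum_congr rfl hx
    _ = _ := by
        have : W.card ≤ K := by simpa using W.card_le_univ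
        rw [sum_const, card_compl, Fintype.card_fin, nsmul_eq_mul, Nat.cast_sub this]
        ring

end Permutations

/-- The chord of the convex function `w ↦ (K - w) / (w + 1)` through `t` and `t + 1` supports it
at all natural numbers. -/
theorem chord_le (K : ℝ) (hK : 0 ≤ K) (t w : ℕ) :
    (K - t) / (t + 1) + t * ((K + 1) / ((t + 1) * (t + 2))) -
      (K + 1) / ((t + 1) * (t + 2)) * w ≤ (K - w) / (w + 1) := by
  -- No integer lies strictly between `t` and `t + 1`; this product is the sign-carrying factor of
  -- the difference.
  have hint : (0 : ℝ) ≤ ((w : ℝ) - t) * (w - t - 1) := by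
    rcases le_or_gt w t with h | h
    · have : (w : ℝ) ≤ t := by exact_mod_cast h
      exact mul_nonneg_of_nonpos_of_nonpos (by linarith) (by linarith)
    · have : (t : ℝ) + 1 ≤ w := by exact_mod_cast h
      exact mul_nonneg (by linarith) (by linarith)
  have : (K - w) / (w + 1) - ((K - t) / (t + 1) + t * ((K + 1) / ((t + 1) * (t + 2))) -
      (K + 1) / ((t + 1) * (t + 2)) * w) =
      (K + 1) * (((w : ℝ) - t) * (w - t - 1)) / ((w + 1) * ((t + 1) * (t + 2))) := by
    field_simp
    ring
  have h2 : 0 ≤ (K + 1) * (((w : ℝ) - t) * (w - t - 1)) / ((w + 1) * ((t + 1) * (t + 2))) := by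
    positivity
  linarith

/-! ### The converse for a single scheme -/

namespace Scheme

variable {N K : ℕ} (S : Scheme N K)

open Classical in
/-- The bits of file `i` that none of the users `σ 0, …, σ j` stores. -/
noncomputable def uncachedUpTo (σ : Equiv.Perm (Fin K)) (j : Fin K) (i : Fin N) :
    Finset (S.Bit i) :=
  univ.filter fun p => ∀ l ≤ j, p ∉ S.cache (σ l) i

theorem mem_uncachedUpTo {σ : Equiv.Perm (Fin K)} {j : Fin K} {i : Fin N} {p : S.Bit i} :
    p ∈ S.uncachedUpTo σ j i ↔ ∀ l ≤ j, p ∉ S.cache (σ l) i := by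
  simp [uncachedUpTo]

/-- The files recovered by the users one after another, each using the files recovered before,
are determined by the signal and the bits outside `uncachedUpTo`. -/
theorem eq_of_recovers {d : Fin K → Fin N} (σ : Equiv.Perm (Fin K)) {F G : S.Library}
    (hF : ∀ k, S.Recovers d k F) (hG : ∀ k, S.Recovers d k G)
    (htx : S.encode d F = S.encode d G)
    (hbits : ∀ i p, (∀ j, d (σ j) = i → p ∉ S.uncachedUpTo σ j i) → F i p = G i p) :
    F = G := by
  have hind : ∀ j, F (d (σ j)) = G (d (σ j)) := by
    intro j
    induction j using WellFoundedLT.induction with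
    | ind j ih =>
      rw [← hF (σ j), ← hG (σ j), htx]
      congr 1
      funext i p
      change F i p.1 = G i p.1
      -- Either an earlier user has recovered file `i`, or only users from `j` on can demand it; a
      -- bit cached by `σ j` is then in none of their sets `uncachedUpTo`.
      by_cases hi : ∃ l < j, d (σ l) = i
      · obtain ⟨l, hl, rfl⟩ := hi
        rw [ih l hl]
      · refine hbits i p.1 fun l hl hp => ?_
        have hjl : j ≤ l := not_lt.1 fun h => hi ⟨l, h, hl⟩
        exact (S.mem_uncachedUpTo.1 hp) j hjl p.2
  funext i p
  by_cases hi : ∃ j, d (σ j) = i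
  · obtain ⟨j, rfl⟩ := hi
    rw [hind j]
  · exact hbits i p fun j hj => (hi ⟨j, hj⟩).elim

/-- The acyclic index coding bound: one bit of slack pays for a total error probability of one
half. -/
theorem sum_card_uncachedUpTo_le {d : Fin K → Fin N} (hinj : Function.Injective d)
    (σ : Equiv.Perm (Fin K)) {ε : ℝ} (herr : ∀ k, S.errorProb d k ≤ ε) (hε : K * ε ≤ 1 / 2) :
    ∑ j, (S.uncachedUpTo σ j (d (σ j))).card ≤ S.signalLength d + 1 := by
  classical
  let ι : (Σ j, S.Bit (d (σ j))) ↪ Σ i, S.Bit i :=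
    ⟨fun q => ⟨d (σ q.1), q.2⟩, Function.Injective.sigma_map (hinj.comp σ.injective)
      fun _ => Function.injective_id⟩
  let E : Finset (Σ i, S.Bit i) :=
    ((univ : Finset (Fin K)).sigma fun j => S.uncachedUpTo σ j (d (σ j))).map ι
  have hE : E.card = ∑ j, (S.uncachedUpTo σ j (d (σ j))).card := by
    rw [card_map, card_sigma]
  let good : Finset S.Library := univ.filter fun F => ∀ k, S.Recovers d k F
  let bad : Fin K → Finset S.Library := fun k => univ.filter fun F => ¬ S.Recovers d k F
  have hLib : Fintype.card S.Library = 2 ^ Fintype.card (Σ i, S.Bit i) := by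
    rw [Fintype.card_congr (Equiv.piCurry fun i (_ : S.Bit i) => ZMod 2).symm]
    simp [ZMod.card]
  have hbad : ∀ k, ((bad k).card : ℝ) ≤ ε * Fintype.card S.Library := by
    intro k
    have h := herr k
    rw [errorProb, Nat.card_eq_fintype_card, Nat.card_eq_fintype_card,
      Fintype.card_subtype, div_le_iff₀ (by rw [hLib]; positivity)] at h
    exact h
  have hcover : Fintype.card S.Library ≤ good.card + ∑ k, (bad k).card := by
    calc Fintype.card S.Library = (univ : Finset S.Library).card := rfl
      _ ≤ (good ∪ univ.biUnion bad).card := by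
          refine card_le_card fun F _ => ?_
          by_cases h : ∀ k, S.Recovers d k F
          · exact mem_union_left _ (by simpa [good] using h)
          · exact mem_union_right _ (by simpa [bad] using h)
      _ ≤ _ := (card_union_le _ _).trans (by gcongr; exact card_biUnion_le)
  -- A library decoded by all users is determined by the signal and its bits outside `E`.
  have hgood : good.card ≤ 2 ^ (S.signalLength d + (Fintype.card (Σ i, S.Bit i) - E.card)) := by
    let φ : S.Library → (S.Tx d → ZMod 2) × ({q : Σ i, S.Bit i // q ∉ E} → ZMod 2) :=
      fun F => (S.encode d F, fun q => F q.1.1 q.1.2)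
    have hφ : Set.InjOn φ good := by
      intro F hF G hG h
      refine S.eq_of_recovers σ (mem_filter.1 hF).2 (mem_filter.1 hG).2
        (congrArg Prod.fst h) fun i p hp => ?_
      refine congrFun (congrArg Prod.snd h) ⟨⟨i, p⟩, fun hmem => ?_⟩
      obtain ⟨⟨j, p'⟩, hq, heq⟩ := mem_map.1 hmem
      change (⟨d (σ j), p'⟩ : Σ i, S.Bit i) = ⟨i, p⟩ at heq
      cases heq
      exact hp j rfl (mem_sigma.1 hq).2
    have := card_le_card_of_injOn φ (fun _ _ => mem_univ _) hφ
    refine this.trans_eq ?_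
    rw [card_univ, Fintype.card_prod, Fintype.card_fun, Fintype.card_fun, ZMod.card,
      Fintype.card_subtype_compl, Fintype.card_coe, ← pow_add]
    rfl
  have hEle : E.card ≤ Fintype.card (Σ i, S.Bit i) := E.card_le_univ
  -- By the union bound, at least half of the libraries are decoded by all users; the factor 2 is
  -- the bit of slack.
  have hhalf : Fintype.card S.Library ≤ 2 * good.card := by
    have h1 : (Fintype.card S.Library : ℝ) ≤ good.card + ∑ k, ((bad k).card : ℝ) := by
      exact_mod_cast hcover
    have h2 : ∑ k, ((bad k).card : ℝ) ≤ K * ε * Fintype.card S.Library := by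
      refine (sum_le_sum fun k _ => hbad k).trans_eq ?_
      simp [mul_assoc]
    have h3 : K * ε * Fintype.card S.Library ≤ 1 / 2 * (Fintype.card S.Library : ℝ) := by
      gcongr
    have : (Fintype.card S.Library : ℝ) ≤ 2 * good.card := by linarith
    exact_mod_cast this
  have hpow : 2 ^ Fintype.card (Σ i, S.Bit i) ≤
      2 ^ (S.signalLength d + (Fintype.card (Σ i, S.Bit i) - E.card) + 1) := by
    rw [← hLib, pow_succ]
    omega
  have := (Nat.pow_le_pow_iff_right (by norm_num)).1 hpow
  omega

/-- The users that store a given bit. -/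
noncomputable def holders (i : Fin N) (p : S.Bit i) : Finset (Fin K) := by
  classical exact univ.filter fun k => p ∈ S.cache k i

theorem mem_holders {i : Fin N} {p : S.Bit i} {k : Fin K} :
    k ∈ S.holders i p ↔ p ∈ S.cache k i := by
  simp [holders]

/-- Double counting of stored bits; through it the caches enter the converse only by their total
size. -/
theorem sum_card_holders :
    ∑ i, ∑ p, (S.holders i p).card = ∑ k, S.cacheLength k := by
  classical
  simp only [cacheLength]
  rw [sum_comm]
  refine sum_congr rfl fun i _ => ?_
  have hdc := sum_card_bipartiteAbove_eq_sum_card_bipartiteBelow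
    (s := (univ : Finset (Fin K))) (t := (univ : Finset (S.Bit i))) (fun k p => p ∈ S.cache k i)
  simp only [bipartiteAbove, bipartiteBelow, filter_univ_mem] at hdc
  rw [hdc]
  exact sum_congr rfl fun p _ => congrArg card (by ext; simp [mem_holders])

/-- The sum over all orderings of the users, and all assignments of consecutive files to them,
of the number of bits in the acyclic index coding bound. -/
theorem sum_sum_card_uncachedUpTo [NeZero N] (e : Fin K → Fin N) :
    ∑ σ : Equiv.Perm (Fin K), ∑ a : Fin N, ∑ j,
      ((S.uncachedUpTo σ j (a + e j)).card : ℝ) =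
    K.factorial * ∑ i, ∑ p, ((K : ℝ) - (S.holders i p).card) / ((S.holders i p).card + 1) := by
  classical
  have h1 : ∀ σ : Equiv.Perm (Fin K), ∑ a : Fin N, ∑ j,
      ((S.uncachedUpTo σ j (a + e j)).card : ℝ) = ∑ i, ∑ p,
      ((univ.filter fun j : Fin K => ∀ l ≤ j, σ l ∉ S.holders i p).card : ℝ) := by
    intro σ
    rw [sum_comm]
    -- For fixed `j` the shifts run through every file once, so cyclic shifts average over the files
    -- even when their sizes differ.
    have h2 : ∀ j, ∑ a : Fin N, ((S.uncachedUpTo σ j (a + e j)).card : ℝ) =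
        ∑ i, ((S.uncachedUpTo σ j i).card : ℝ) := fun j =>
      Equiv.sum_comp (Equiv.addRight (e j)) fun i => ((S.uncachedUpTo σ j i).card : ℝ)
    rw [sum_congr rfl fun j _ => h2 j, sum_comm]
    refine sum_congr rfl fun i _ => ?_
    have hdc := sum_card_bipartiteAbove_eq_sum_card_bipartiteBelow
      (s := (univ : Finset (Fin K))) (t := (univ : Finset (S.Bit i)))
      (fun j p => ∀ l ≤ j, σ l ∉ S.holders i p)
    simp only [bipartiteAbove, bipartiteBelow] at hdc
    have h3 : ∀ j, S.uncachedUpTo σ j i =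
        univ.filter fun p => ∀ l ≤ j, σ l ∉ S.holders i p := by
      intro j; ext p; simp [mem_uncachedUpTo, mem_holders]
    simp only [h3]
    exact_mod_cast hdc
  simp only [h1]
  rw [sum_comm, mul_sum]
  refine sum_congr rfl fun i _ => ?_
  rw [sum_comm, mul_sum]
  exact sum_congr rfl fun p _ => sum_perm_card_before _

/-- The converse for one scheme, with the bound given by the chord through `t` and `t + 1`. -/
theorem chord_bound (hN : 0 < N) (hKN : K ≤ N) {ε R : ℝ} (hε : K * ε ≤ 1 / 2)
    (herr : ∀ d k, S.errorProb d k ≤ ε) (hR : ∀ d, (S.signalLength d : ℝ) ≤ R) (t : ℕ) :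
    (((K : ℝ) - t) / (t + 1) + t * ((K + 1) / ((t + 1) * (t + 2)))) * ∑ i, (S.fileLength i : ℝ) -
      (K + 1) / ((t + 1) * (t + 2)) * ∑ k, (S.cacheLength k : ℝ) ≤ N * (R + 1) := by
  have : NeZero N := ⟨hN.ne'⟩
  have hfac : (0 : ℝ) < K.factorial := by exact_mod_cast K.factorial_pos
  have hchord : (((K : ℝ) - t) / (t + 1) + t * ((K + 1) / ((t + 1) * (t + 2)))) *
      ∑ i, (S.fileLength i : ℝ) -
      (K + 1) / ((t + 1) * (t + 2)) * ∑ k, (S.cacheLength k : ℝ) ≤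
      ∑ i, ∑ p, ((K : ℝ) - (S.holders i p).card) / ((S.holders i p).card + 1) := by
    have h1 : ∑ k, (S.cacheLength k : ℝ) = ∑ i, ∑ p, ((S.holders i p).card : ℝ) := by
      exact_mod_cast S.sum_card_holders.symm
    have h2 : ∑ i, (S.fileLength i : ℝ) = ∑ i, ∑ _p : S.Bit i, (1 : ℝ) := by
      simp [fileLength]
    rw [h1, h2, mul_sum, mul_sum, ← sum_sub_distrib]
    refine sum_le_sum fun i _ => ?_
    rw [mul_sum, mul_sum, ← sum_sub_distrib]
    refine sum_le_sum fun p _ => ?_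
    rw [mul_one]
    exact chord_le K K.cast_nonneg t _
  refine hchord.trans ?_
  have hsum : ∑ σ : Equiv.Perm (Fin K), ∑ a : Fin N, ∑ j,
      ((S.uncachedUpTo σ j (a + Fin.castLE hKN j)).card : ℝ) ≤ K.factorial * (N * (R + 1)) := by
    have h : ∀ (σ : Equiv.Perm (Fin K)) (a : Fin N), ∑ j,
        ((S.uncachedUpTo σ j (a + Fin.castLE hKN j)).card : ℝ) ≤ R + 1 := by
      intro σ a
      -- The user at position `j` demands file `a + j` modulo `N`; these files are distinct since `K
      -- ≤ N`.
      have hinj : Function.Injective fun k => a + Fin.castLE hKN (σ.symm k) := fun x y hxy =>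
        σ.symm.injective (Fin.castLE_injective hKN (add_left_cancel hxy))
      have hb := S.sum_card_uncachedUpTo_le hinj σ (herr _) hε
      have hd : ∀ j, (S.uncachedUpTo σ j (a + Fin.castLE hKN (σ.symm (σ j)))).card =
          (S.uncachedUpTo σ j (a + Fin.castLE hKN j)).card := fun j =>
        congrArg (fun l => (S.uncachedUpTo σ j (a + Fin.castLE hKN l)).card)
          (σ.symm_apply_apply j)
      rw [sum_congr rfl fun j _ => hd j] at hb
      refine le_trans ?_ (add_le_add_left (hR fun k => a + Fin.castLE hKN (σ.symm k)) 1)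
      exact_mod_cast hb
    refine (sum_le_sum fun σ _ => sum_le_sum fun a _ => h σ a).trans_eq ?_
    simp [Fintype.card_perm]
    ring
  rw [S.sum_sum_card_uncachedUpTo] at hsum
  exact le_of_mul_le_mul_left hsum hfac

end Scheme

end CodedCaching

/-! ### The converse for achievable loads, and the theorem -/

namespace CodedCaching

open Finset

/-- No load below the interpolated curve is achievable with uncoded placement. -/
theorem optimalLoad_le {N K : ℕ} (hK : 0 < K) (hKN : K ≤ N) {M : ℝ} (hM0 : 0 ≤ M)
    (hMN : M ≤ N) {f : Fin N → ℝ} {m : Fin K → ℝ} {L : ℝ}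
    (hf : 1 ≤ (1 / (N : ℝ)) * ∑ i, f i) (hm : (1 / (K : ℝ)) * ∑ k, m k ≤ M)
    (hL : AchievableBy Set.univ f m L) : optimalLoad N K M ≤ L := by
  have hN : 0 < N := hK.trans_le hKN
  have hK' : (0 : ℝ) < K := by positivity
  have hN' : (0 : ℝ) < N := by positivity
  rw [one_div_mul_eq_div, le_div_iff₀ hN', one_mul] at hf
  rw [one_div_mul_eq_div, div_le_iff₀ hK'] at hm
  have hx : 0 ≤ K * M / N := by positivity
  set t := ⌊K * M / N⌋₊
  have ht1 : (t : ℝ) ≤ K * M / N := Nat.floor_le hx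
  have ht2 : K * M / N < t + 1 := Nat.lt_floor_add_one _
  have htK : (t : ℝ) ≤ K := by
    refine ht1.trans ?_
    rw [div_le_iff₀ hN']
    gcongr
  -- The chord is `w ↦ α - β * w`, evaluated below at `w = K * M / N`. Both coefficients must be
  -- nonnegative because the size constraints are inequalities.
  set β : ℝ := (K + 1) / ((t + 1) * (t + 2)) with hβ
  set α : ℝ := ((K : ℝ) - t) / (t + 1) + t * β with hα
  have hβ0 : 0 ≤ β := by positivity
  have hα0 : 0 ≤ α := by
    have : 0 ≤ ((K : ℝ) - t) / (t + 1) := div_nonneg (by linarith) (by positivity)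
    positivity
  have hopt : optimalLoad N K M = α - β * (K * M / N) := by
    rw [optimalLoad_eq hK hN (θ := K * M / N - t) t (by ring) (by linarith) (by linarith), hα, hβ]
    field_simp
    ring
  refine le_of_forall_pos_le_add fun δ hδ => ?_
  -- The second bound keeps the total error probability of the `K` users at most one half.
  set ε : ℝ := min δ (1 / (2 * K)) with hε
  have hε0 : 0 < ε := lt_min hδ (by positivity)
  have hεK : K * ε ≤ 1 / 2 := by
    calc K * ε ≤ K * (1 / (2 * K)) := by gcongr; exact min_le_right _ _
      _ = 1 / 2 := by field_simp
  refine le_trans ?_ (add_le_add_right (min_le_left δ (1 / (2 * K))) L)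
  rw [← hε]
  by_contra! hlt
  -- For such `b` the assumed gap exceeds one bit, the slack in `chord_bound`.
  have hlarge : ∀ᶠ b : ℕ in atTop, 1 / (optimalLoad N K M - (L + ε)) < b :=
    tendsto_natCast_atTop_atTop.eventually_gt_atTop _
  obtain ⟨b, ⟨S, -, hlen, hcache, hsig, herr⟩, hb⟩ := ((hL ε hε0).and hlarge).exists
  rw [div_lt_iff₀ (by linarith)] at hb
  have hbound := S.chord_bound hN hKN hεK herr hsig t
  have hfiles : (N : ℝ) * b ≤ ∑ i, (S.fileLength i : ℝ) := by
    calc (N : ℝ) * b ≤ (∑ i, f i) * b := by gcongr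
      _ = ∑ i, f i * b := sum_mul _ _ _
      _ ≤ _ := sum_le_sum fun i _ => by rw [hlen]; exact Nat.le_ceil _
  have hcaches : ∑ k, (S.cacheLength k : ℝ) ≤ M * K * b := by
    calc _ ≤ ∑ k, m k * b := sum_le_sum fun k _ => hcache k
      _ = (∑ k, m k) * b := (sum_mul _ _ _).symm
      _ ≤ _ := by gcongr
  have h1 := mul_le_mul_of_nonneg_left hfiles hα0
  have h2 := mul_le_mul_of_nonneg_left hcaches hβ0
  have h3 : (N : ℝ) * (optimalLoad N K M * b) ≤ N * ((L + ε) * b + 1) := by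
    have : (N : ℝ) * (optimalLoad N K M * b) = α * (N * b) - β * (M * K * b) := by
      rw [hopt]; field_simp
    rw [this]
    linarith
  have h4 := le_of_mul_le_mul_left h3 hN'
  linarith

end CodedCaching

/-- For `1 ≤ K ≤ N` and `0 ≤ M ≤ N`, with uncoded placement and only the total file size and the
total cache size fixed: the minimum worst-case load is the interpolated curve; it is attained with
files of equal length and caches of equal size by coded caching; the exact performance of coded
caching at a corner point; and its exact performance when time-sharing two adjacent ones. -/
theorem theorem3 (N K : ℕ) (hK : 1 ≤ K) (hKN : K ≤ N) (M : ℝ) (hM0 : 0 ≤ M) (hMN : M ≤ N) :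
    IsLeast (CodedCaching.achievableLoads N K M) (CodedCaching.optimalLoad N K M) ∧
    CodedCaching.AchievableBy {S : CodedCaching.Scheme N K | CodedCaching.IsCodedCaching S}
      (fun _ => 1) (fun _ => M) (CodedCaching.optimalLoad N K M) ∧
    (∀ t : ℕ, t ≤ K → M = t * N / K →
      CodedCaching.optimalLoad N K M = K * (1 - M / N) * (1 / (1 + K * M / N)) ∧
      ∀ c : ℕ, (CodedCaching.manScheme N K t c).Performs (K.choose t * c) M
        (CodedCaching.optimalLoad N K M)) ∧
    (∀ t c c' b b' : ℕ, t < K → b = K.choose t * c → b' = K.choose (t + 1) * c' →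
      M * (b + b') = b * (t * N / K) + b' * ((t + 1) * N / K) →
      (CodedCaching.timeShare (CodedCaching.manScheme N K t c)
        (CodedCaching.manScheme N K (t + 1) c')).Performs (b + b') M
        (CodedCaching.optimalLoad N K M)) := by
  have hN : 0 < N := hK.trans hKN
  have hach := CodedCaching.achievableBy_isCodedCaching (N := N) (K := K) hK hN hM0 hMN
  refine ⟨⟨⟨fun _ => 1, fun _ => M, fun _ => zero_le_one, fun _ => hM0, ?_, ?_, fun ε hε => ?_⟩,
    ?_⟩, hach, fun t _ hM => ⟨?_, fun c => CodedCaching.manScheme_performs hK hN t c hM⟩,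
    fun t c c' b b' _ => CodedCaching.timeShare_performs hK hN t c c' b b'⟩
  · simp [hN.ne']
  · simp [(show K ≠ 0 by omega)]
  · filter_upwards [hach ε hε] with b hb
    obtain ⟨S, -, hS⟩ := hb
    exact ⟨S, Set.mem_univ _, hS⟩
  · rintro L ⟨f, m, -, -, hf, hm, hL⟩
    exact CodedCaching.optimalLoad_le hK hKN hM0 hMN hf hm hL
  · have hM' : K * M / N = t + 0 := by
      have : (K : ℝ) ≠ 0 := by positivity
      have : (N : ℝ) ≠ 0 := by positivity
      rw [hM]; field_simp; simp
    rw [CodedCaching.optimalLoad_eq hK hN t hM' le_rfl zero_le_one]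
    change _ = CodedCaching.cornerLoad N K M
    rw [hM, CodedCaching.cornerLoad_corner hK hN]
    ring
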